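/- For a finite group $G$, let $G\otimes G$ be its nonabelian tensor square, i.e. the group generated by symbols $x\otimes h$ ($x,h\in G$) subject to the relations $xy\otimes h=({}^{x}y\otimes{}^{x}h)(x\otimes h)$ and $x\otimes hk=(x\otimes h)({}^{h}x\otimes{}^{h}k)$ for all $x,y,h,k\in G$, where ${}^{x}y=xyx^{-1}$. The tensor degree of $G$ is $$d^\otimes(G)=\frac{|\{(x,y)\in G\times G : x\otimes y=1\}|}{|G|^2}.$$ Let $D_{2^n}=\langle a,b\mid b^2=a^{2^{n-1}}=1,\ b^{-1}ab=a^{-1}\rangle$ be the dihedral group of order $2^n$, let $Q_{2^n}=\langle a,b\mid b^2=a^{2^{n-2}},\ b^{-1}ab=a^{-1}\rangle$ be the generalized quaternion group of order $2^n$, and for a prime $p$ let $E_1=\langle a,b,c\mid a^p=b^p=c^p=1,\ [a,c]=[b,c]=1,\ [a,b]=c\rangle$ with $[x,y]=x^{-1}y^{-1}xy$, which for odd $p$ is the extraspecial group of order $p^3$ and exponent $p$. A $p$-group $H$ is called extraspecial if $Z(H)=H'$ has order $p$ and $H/Z(H)$ is elementary abelian. Then: (i) $d^\otimes(Q_{2^n})=\dfrac{2^{n-3}+2^{n-4}+1}{2^n}$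 for all $n>3$, and $d^\otimes(Q_8)=\dfrac14$. (ii) $d^\otimes(D_{2^n})=\dfrac{2^{n-3}+2^{n-4}+1}{2^n}$ for all $n>3$, and $d^\otimes(D_8)=\dfrac5{16}$. (iii) $d^\otimes(E_1)=\dfrac{2p^2+p-2}{p^5}$ for every odd prime $p$. (iv) Let $p$ be a prime, $m\ge1$, and let $H$ be an extraspecial $p$-group of order $p^{2m+1}$ that is not isomorphic to $E_1$, $Q_8$ or $D_8$. Then $d^\otimes(H)=\dfrac{2p^{2m}-1}{p^{4m}}$. -/

import Mathlib

namespace TensorDegree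

/-- The defining relators of the nonabelian tensor square, with `G` acting on itself by the
left conjugation `ˣy = x y x⁻¹`:
`xy ⊗ h = (ˣy ⊗ ˣh) (x ⊗ h)` and `x ⊗ hk = (x ⊗ h) (ʰx ⊗ ʰk)`.
The generator `FreeGroup.of (x, h)` stands for the symbol `x ⊗ h`. -/
def tensorRels (G : Type*) [Group G] : Set (FreeGroup (G × G)) :=
  {r | ∃ x y h : G, r = FreeGroup.of (x * y, h) *
      (FreeGroup.of (x * y * x⁻¹, x * h * x⁻¹) * FreeGroup.of (x, h))⁻¹} ∪
  {r | ∃ x h k : G, r = FreeGroup.of (x, h * k) *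
      (FreeGroup.of (x, h) * FreeGroup.of (h * x * h⁻¹, h * k * h⁻¹))⁻¹}

/-- The nonabelian tensor square `G ⊗ G`. -/
abbrev TensorSquare (G : Type*) [Group G] : Type _ :=
  PresentedGroup (tensorRels G)

/-- The element `x ⊗ y` of `G ⊗ G`. -/
def tmul {G : Type*} [Group G] (x y : G) : TensorSquare G :=
  PresentedGroup.of (x, y)

/-- The tensor degree `|{(x, y) ∈ G × G : x ⊗ y = 1}| / |G|²` of a finite group `G`. -/
noncomputable def tensorDegree (G : Type*) [Group G] : ℚ :=
  (Nat.card {z : G × G // tmul z.1 z.2 = 1} : ℚ) / (Nat.card G : ℚ) ^ 2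

/-- The relators of `⟨a, b, c | aᵖ = bᵖ = cᵖ = 1, [a, c] = [b, c] = 1, [a, b] = c⟩`,
where `[x, y] = x⁻¹ y⁻¹ x y` and `a, b, c` are the generators with index `0, 1, 2`. -/
def extraspecialRels (p : ℕ) : Set (FreeGroup (Fin 3)) :=
  let a : FreeGroup (Fin 3) := FreeGroup.of 0
  let b : FreeGroup (Fin 3) := FreeGroup.of 1
  let c : FreeGroup (Fin 3) := FreeGroup.of 2
  {a ^ p, b ^ p, c ^ p, a⁻¹ * c⁻¹ * a * c, b⁻¹ * c⁻¹ * b * c, a⁻¹ * b⁻¹ * a * b * c⁻¹}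

/-- The group `E₁ = ⟨a, b, c | aᵖ = bᵖ = cᵖ = 1, [a, c] = [b, c] = 1, [a, b] = c⟩`; for an odd
prime `p` it is the extraspecial group of order `p³` and exponent `p`. -/
abbrev ExtraspecialE1 (p : ℕ) : Type :=
  PresentedGroup (extraspecialRels p)

/-- Extraspecial `p`-groups: `p`-groups `H` with `Z(H) = H'` of order `p` and with `H / Z(H)`
elementary abelian. -/
structure IsExtraspecial (p : ℕ) (H : Type*) [Group H] : Prop where
  isPGroup : IsPGroup p H
  commutator_eq_center : commutator H = Subgroup.center H
  card_center : Nat.card (Subgroup.center H) = p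
  pow_mem_center : ∀ x : H, x ^ p ∈ Subgroup.center H

end TensorDegree

/-!
A crossed pairing on `G`, that is, a homomorphism out of `G ⊗ G`, certifies `x ⊗ y ≠ 1`. Products
of two characters do this for most pairs. The finer ones come from central extensions `Ĝ → G`: the
commutator of lifts of `x` and `y` to `Ĝ` depends only on `x` and `y`. For the dihedral and
quaternion groups this is half of the commutator of `G`, and for the Heisenberg group it comes from
a group of class three.

Conversely, `[x, y]` acts on `G ⊗ G` as conjugation by `x ⊗ y`, which gives
`h ⊗ [x, y] = ʰ(x ⊗ y) (x ⊗ y)⁻¹`, so this tensor vanishes when `h` commutes with `x` and `y`.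
If `b` inverts `a`, it follows that `(a ⊗ a)⁴ = 1` and `a ⊗ b² = (a ⊗ a)²`. Hence `(a ⊗ a)² = 1`
in the dihedral groups, where `b² = 1`, and in the quaternion groups other than `Q₈`, where `b²` is
a power of `a⁴`. The pairs are then counted coset by coset.

In an extraspecial group a tensor of two noncentral elements is nontrivial, so the count only
depends on whether `h ⊗ z = 1` for all `h` and all central `z`. If the order exceeds `p³`, the
centralizer of each `h` is nonabelian and hence has commutator subgroup `Z(H)`. If the order is `p³`
with `p` odd and `gᵖ ≠ 1`, then `Z(H)` is generated by `gᵖ`; now `[g, y] ⊗ g = (g ⊗ [g, y])⁻¹`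
yields `z ⊗ g = 1` for central `z`, and so `h ⊗ gᵖ = (h ⊗ g)ᵖ = hᵖ ⊗ g = 1` for all `h`. The
remaining groups of order `p³` are `E₁`, which is the Heisenberg group over `ℤ/p` (and `D₈` for
`p = 2`), and `Q₈`.
-/

namespace TensorDegree

open scoped commutatorElement

section TensorSquare

variable {G L : Type*} [Group G] [Group L]

theorem tmul_mul_left (x y h : G) :
    tmul (x * y) h = tmul (x * y * x⁻¹) (x * h * x⁻¹) * tmul x h :=
  mul_inv_eq_one.1 <| PresentedGroup.one_of_mem (rels := tensorRels G) (Or.inl ⟨x, y, h, rfl⟩)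

theorem tmul_mul_right (x h k : G) :
    tmul x (h * k) = tmul x h * tmul (h * x * h⁻¹) (h * k * h⁻¹) :=
  mul_inv_eq_one.1 <| PresentedGroup.one_of_mem (rels := tensorRels G) (Or.inr ⟨x, h, k, rfl⟩)

/-- The crossed pairings of Brown and Loday: the functions `G × G → L` that satisfy the defining
relations of `G ⊗ G`, with `G` acting on itself by conjugation. -/
structure IsCrossedPairing (f : G → G → L) : Prop where
  map_mul_left : ∀ x y h, f (x * y) h = f (x * y * x⁻¹) (x * h * x⁻¹) * f x h
  map_mul_right : ∀ x h k, f x (h * k) = f x h * f (h * x * h⁻¹) (h * k * h⁻¹)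

namespace IsCrossedPairing

/-- The homomorphism `G ⊗ G → L` induced by a crossed pairing. -/
def lift {f : G → G → L} (hf : IsCrossedPairing f) : TensorSquare G →* L :=
  PresentedGroup.toGroup (f := fun z : G × G => f z.1 z.2) <| by
    rintro r (⟨x, y, h, rfl⟩ | ⟨x, h, k, rfl⟩)
    · simpa [mul_inv_eq_one, ← mul_inv_rev] using hf.map_mul_left x y h
    · simpa [mul_inv_eq_one, ← mul_inv_rev] using hf.map_mul_right x h k

@[simp]
theorem lift_tmul {f : G → G → L} (hf : IsCrossedPairing f) (x y : G) :
    hf.lift (tmul x y) = f x y :=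
  PresentedGroup.toGroup.of _

theorem eq_one_of_tmul_eq_one {f : G → G → L} (hf : IsCrossedPairing f) {x y : G}
    (h : tmul x y = 1) : f x y = 1 := by
  rw [← hf.lift_tmul, h, map_one]

end IsCrossedPairing

theorem isCrossedPairing_ofAdd {A : Type*} [AddCommGroup A] {f : G → G → A}
    (hl : ∀ x y h, f (x * y) h = f (x * y * x⁻¹) (x * h * x⁻¹) + f x h)
    (hr : ∀ x h k, f x (h * k) = f x h + f (h * x * h⁻¹) (h * k * h⁻¹)) :
    IsCrossedPairing fun x y => Multiplicative.ofAdd (f x y) where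
  map_mul_left x y h := congrArg Multiplicative.ofAdd (hl x y h)
  map_mul_right x h k := congrArg Multiplicative.ofAdd (hr x h k)

theorem isCrossedPairing_hom_mul_hom {R : Type*} [CommRing R] (f g : G →* Multiplicative R) :
    IsCrossedPairing fun x y => Multiplicative.ofAdd ((f x).toAdd * (g y).toAdd) :=
  isCrossedPairing_ofAdd
    (fun x y h => by simp only [map_mul, map_inv, toAdd_mul, toAdd_inv]; ring)
    (fun x h k => by simp only [map_mul, map_inv, toAdd_mul, toAdd_inv]; ring)

theorem hom_mul_hom_eq_zero {R : Type*} [CommRing R] (f g : G →* Multiplicative R) {x y : G}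
    (h : tmul x y = 1) : (f x).toAdd * (g y).toAdd = 0 :=
  (isCrossedPairing_hom_mul_hom f g).eq_one_of_tmul_eq_one h

theorem isCrossedPairing_map (φ : G →* L) : IsCrossedPairing fun x y => tmul (φ x) (φ y) where
  map_mul_left x y h := by simp only [map_mul, map_inv, ← tmul_mul_left]
  map_mul_right x h k := by simp only [map_mul, map_inv, ← tmul_mul_right]

theorem tensorDegree_congr (e : G ≃* L) : tensorDegree G = tensorDegree L := by
  have hpairs : Nat.card {z : G × G // tmul z.1 z.2 = 1} =
      Nat.card {z : L × L // tmul z.1 z.2 = 1} := by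
    refine Nat.card_congr ((e.toEquiv.prodCongr e.toEquiv).subtypeEquiv fun z =>
      ⟨(isCrossedPairing_map e.toMonoidHom).eq_one_of_tmul_eq_one, fun h => ?_⟩)
    simpa using (isCrossedPairing_map e.symm.toMonoidHom).eq_one_of_tmul_eq_one h
  rw [tensorDegree, tensorDegree, hpairs, Nat.card_congr e.toEquiv]

theorem isCrossedPairing_swap : IsCrossedPairing fun x y : G => (tmul y x)⁻¹ where
  map_mul_left x y h := by rw [tmul_mul_right, mul_inv_rev]
  map_mul_right x h k := by rw [tmul_mul_left, mul_inv_rev]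

theorem tmul_eq_one_comm {x y : G} : tmul x y = 1 ↔ tmul y x = 1 :=
  ⟨fun h => inv_eq_one.1 (isCrossedPairing_swap.eq_one_of_tmul_eq_one h),
    fun h => inv_eq_one.1 (isCrossedPairing_swap.eq_one_of_tmul_eq_one h)⟩

@[simp]
theorem tmul_one_left (h : G) : tmul 1 h = 1 := by
  simpa using tmul_mul_left 1 1 h

@[simp]
theorem tmul_one_right (x : G) : tmul x 1 = 1 :=
  tmul_eq_one_comm.1 (tmul_one_left x)

theorem monoidHom_ext {f g : TensorSquare G →* L} (h : ∀ x y, f (tmul x y) = g (tmul x y)) :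
    f = g :=
  PresentedGroup.ext fun z => h z.1 z.2

end TensorSquare

section ConjugationAction

variable {G : Type*} [Group G]

instance : MulDistribMulAction G (TensorSquare G) where
  smul g := (isCrossedPairing_map (MulAut.conj g).toMonoidHom).lift
  one_smul t := by
    refine DFunLike.congr_fun (f := (isCrossedPairing_map _).lift) (g := MonoidHom.id _)
      (monoidHom_ext fun x y => ?_) t
    simp
  mul_smul g h t := by
    refine DFunLike.congr_fun (f := (isCrossedPairing_map _).lift)
      (g := (isCrossedPairing_map (MulAut.conj g).toMonoidHom).lift.comp
        (isCrossedPairing_map (MulAut.conj h).toMonoidHom).lift) (monoidHom_ext fun x y => ?_) t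
    simp
  smul_mul g := map_mul _
  smul_one g := map_one _

theorem smul_tmul (g x y : G) : g • tmul x y = tmul (g * x * g⁻¹) (g * y * g⁻¹) :=
  (isCrossedPairing_map (MulAut.conj g).toMonoidHom).lift_tmul x y

theorem mul_tmul (x y h : G) : tmul (x * y) h = x • tmul y h * tmul x h := by
  rw [smul_tmul, tmul_mul_left]

theorem tmul_mul (x h k : G) : tmul x (h * k) = tmul x h * h • tmul x k := by
  rw [smul_tmul, tmul_mul_right]

theorem inv_tmul (x h : G) : tmul x⁻¹ h = (x⁻¹ • tmul x h)⁻¹ := by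
  have hx := mul_tmul x⁻¹ x h
  rw [inv_mul_cancel, tmul_one_left] at hx
  exact eq_inv_of_mul_eq_one_right hx.symm

theorem tmul_inv (x h : G) : tmul x h⁻¹ = (h⁻¹ • tmul x h)⁻¹ := by
  have hh := tmul_mul x h⁻¹ h
  rw [inv_mul_cancel, tmul_one_right] at hh
  exact eq_inv_of_mul_eq_one_left hh.symm

-- Expand `xu ⊗ yv` in both orders.
theorem smul_mul_tmul (x y u v : G) :
    (x * y) • tmul u v * tmul x y = tmul x y * (y * x) • tmul u v := by
  have hleft : tmul (x * u) (y * v) =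
      x • tmul u y * ((x * y) • tmul u v * tmul x y) * y • tmul x v := by
    rw [mul_tmul, tmul_mul x, tmul_mul u, smul_mul', smul_smul]
    simp only [mul_assoc]
  have hright : tmul (x * u) (y * v) =
      x • tmul u y * (tmul x y * (y * x) • tmul u v) * y • tmul x v := by
    rw [tmul_mul, mul_tmul, mul_tmul x u v, smul_mul', smul_smul]
    simp only [mul_assoc]
  exact mul_left_cancel (mul_right_cancel (hleft.symm.trans hright))

theorem tmul_mul_mul_tmul_inv (x y : G) (t : TensorSquare G) :
    tmul x y * t * (tmul x y)⁻¹ = ⁅x, y⁆ • t := by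
  refine DFunLike.congr_fun (f := (MulAut.conj (tmul x y)).toMonoidHom)
    (g := MulDistribMulAction.toMonoidHom _ ⁅x, y⁆) (monoidHom_ext fun u v => ?_) t
  have h := smul_mul_tmul x y ((y * x)⁻¹ * u * ((y * x)⁻¹)⁻¹) ((y * x)⁻¹ * v * ((y * x)⁻¹)⁻¹)
  rw [← smul_tmul, smul_smul, smul_smul, mul_inv_cancel, one_smul,
    show x * y * (y * x)⁻¹ = ⁅x, y⁆ by rw [commutatorElement_def]; group] at h
  exact mul_inv_eq_iff_eq_mul.2 h.symm

theorem commute_tmul {x y : G} (h : Commute x y) (t : TensorSquare G) : Commute (tmul x y) t := by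
  have ht := tmul_mul_mul_tmul_inv x y t
  rwa [commutatorElement_eq_one_iff_commute.2 h, one_smul, mul_inv_eq_iff_eq_mul] at ht

theorem smul_tmul_of_commute {g x y : G} (hx : Commute g x) (hy : Commute g y) :
    g • tmul x y = tmul x y := by
  rw [smul_tmul, hx.mul_inv_cancel, hy.mul_inv_cancel]

theorem tmul_pow_left {x y : G} (h : Commute x y) (n : ℕ) : tmul (x ^ n) y = tmul x y ^ n := by
  induction n with
  | zero => simp
  | succ n ih =>
    rw [pow_succ', mul_tmul, ih, smul_pow', smul_tmul_of_commute (Commute.refl x) h, pow_succ]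

theorem tmul_pow_right {x y : G} (h : Commute x y) (n : ℕ) : tmul x (y ^ n) = tmul x y ^ n := by
  induction n with
  | zero => simp
  | succ n ih =>
    rw [pow_succ', tmul_mul, ih, smul_pow', smul_tmul_of_commute h.symm (Commute.refl y), pow_succ']

theorem tmul_pow_pow (x : G) (m n : ℕ) : tmul (x ^ m) (x ^ n) = tmul x x ^ (m * n) := by
  rw [tmul_pow_left (Commute.self_pow x n), tmul_pow_right (Commute.refl x), ← pow_mul, mul_comm]

theorem tmul_commutator_left (x y h : G) :
    tmul ⁅x, y⁆ h = tmul x y * (h • tmul x y)⁻¹ := by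
  have hconj : tmul (y * x⁻¹ * y⁻¹) h = (y • x⁻¹ • tmul x (y⁻¹ * h * y))⁻¹ := by
    rw [← smul_inv', ← inv_tmul, smul_tmul]
    group
  have hexpand : tmul x y * y • tmul x (y⁻¹ * h * y) = tmul x h * h • tmul x y := by
    rw [← tmul_mul, ← tmul_mul]
    group
  calc tmul ⁅x, y⁆ h
      = x • tmul (y * x⁻¹ * y⁻¹) h * tmul x h := by
        rw [← mul_tmul, commutatorElement_def]
        group
    _ = (⁅x, y⁆ • y • tmul x (y⁻¹ * h * y))⁻¹ * tmul x h := by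
        rw [hconj, smul_inv', smul_smul, smul_smul, smul_smul, commutatorElement_def]
        group
    _ = (tmul x h * h • tmul x y * (tmul x y)⁻¹)⁻¹ * tmul x h := by
        rw [← tmul_mul_mul_tmul_inv, hexpand]
    _ = tmul x y * (h • tmul x y)⁻¹ := by group

theorem tmul_commutator_right (x y h : G) :
    tmul h ⁅x, y⁆ = h • tmul x y * (tmul x y)⁻¹ := by
  have hswap : tmul h ⁅y, x⁆ = (h • tmul x y)⁻¹ * tmul x y := by
    have hinv := congrArg isCrossedPairing_swap.lift (tmul_commutator_left y x h)
    simp only [smul_tmul, map_mul, map_inv, IsCrossedPairing.lift_tmul, inv_inv] at hinv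
    rw [inv_eq_iff_eq_inv.1 hinv, mul_inv_rev, smul_tmul, inv_inv]
  rw [← commutatorElement_inv, tmul_inv, hswap, commutatorElement_inv, ← tmul_mul_mul_tmul_inv]
  group

theorem tmul_commutator_self (x y : G) : tmul ⁅x, y⁆ x = (tmul x ⁅x, y⁆)⁻¹ := by
  rw [tmul_commutator_left, tmul_commutator_right, mul_inv_rev, inv_inv]

theorem tmul_pow_left_of_commute_commutator {g y : G} (h : Commute g ⁅g, y⁆) (n : ℕ) :
    tmul (g ^ n) y = tmul g ⁅g, y⁆ ^ n.choose 2 * tmul g y ^ n := by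
  induction n with
  | zero => simp
  | succ n ih =>
    have hsmul : g ^ n • tmul g y = tmul g ⁅g, y⁆ ^ n * tmul g y := by
      rw [← tmul_pow_left h, tmul_commutator_right, inv_mul_cancel_right]
    rw [pow_succ, mul_tmul, hsmul, ih, Nat.choose_succ_succ' n 1, Nat.choose_one_right, pow_add,
      pow_succ', mul_assoc, mul_assoc, (commute_tmul h _).symm.pow_right _ |>.left_comm]

theorem commutator_eq_sq_of_inverts {a b : G} (h : b * a * b⁻¹ = a⁻¹) : ⁅a, b⁆ = a ^ 2 := by
  rw [commutatorElement_def, mul_assoc, mul_assoc, ← mul_assoc b, ← conj_inv, h, inv_inv, sq]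

theorem tmul_self_pow_four_of_inverts {a b : G} (h : b * a * b⁻¹ = a⁻¹) : tmul a a ^ 4 = 1 := by
  have hself := tmul_commutator_self a b
  rw [commutator_eq_sq_of_inverts h, tmul_pow_left (Commute.refl a),
    tmul_pow_right (Commute.refl a), eq_inv_iff_mul_eq_one, ← pow_add] at hself
  exact hself

theorem tmul_sq_of_inverts {a b : G} (h : b * a * b⁻¹ = a⁻¹) : tmul a (b ^ 2) = tmul a a ^ 2 := by
  have hb : b • tmul a b = (a⁻¹ • tmul a b)⁻¹ := by
    rw [smul_tmul, h, mul_inv_cancel_right, inv_tmul]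
  calc tmul a (b ^ 2)
      = a⁻¹ • (a • tmul a b * (tmul a b)⁻¹) := by
        rw [sq, tmul_mul, hb, smul_mul', inv_smul_smul, smul_inv']
    _ = a⁻¹ • tmul a a ^ 2 := by
        rw [← tmul_commutator_right, commutator_eq_sq_of_inverts h, tmul_pow_right (Commute.refl a)]
    _ = tmul a a ^ 2 := by
        rw [smul_pow', smul_tmul_of_commute (Commute.refl a).inv_left (Commute.refl a).inv_left]

end ConjugationAction

section Parity

variable {n : ℕ}

/-- Reduction modulo two on the integers modulo an even number. -/
def parity (n : ℕ) : ZMod (2 * n) →+* ZMod 2 :=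
  ZMod.castHom (Dvd.intro n rfl) (ZMod 2)

variable [NeZero n]

theorem parity_mul_parity_eq_zero_iff (i j : ZMod (2 * n)) :
    parity n i * parity n j = 0 ↔ 2 ∣ i.val * j.val := by
  have hval (k : ZMod (2 * n)) : parity n k = (k.val : ZMod 2) := by
    rw [← map_natCast (parity n), ZMod.natCast_zmod_val]
  rw [hval, hval, ← Nat.cast_mul, ZMod.natCast_eq_zero_iff]

theorem tmul_pow_val_eq_one {G : Type*} [Group G] {x : G} (hx : tmul x x ^ 2 = 1)
    {i j : ZMod (2 * n)} (h : parity n i * parity n j = 0) :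
    tmul (x ^ i.val) (x ^ j.val) = 1 := by
  obtain ⟨k, hk⟩ := (parity_mul_parity_eq_zero_iff i j).1 h
  rw [tmul_pow_pow, hk, pow_mul, hx, one_pow]

theorem card_parity_ne_zero : (Finset.univ.filter fun i => parity n i ≠ 0).card = n := by
  have hshift : (Finset.univ.filter fun i => parity n i ≠ 0).card =
      (Finset.univ.filter fun i => ¬ parity n i ≠ 0).card := by
    refine Finset.card_equiv (Equiv.addRight 1) fun i => ?_
    have hflip : ∀ t : ZMod 2, t ≠ 0 ↔ ¬ t + 1 ≠ 0 := by decide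
    simp only [Finset.mem_filter, Finset.mem_univ, true_and, Equiv.coe_addRight, map_add, map_one,
      hflip (parity n i)]
  have htotal := Finset.card_filter_add_card_filter_not (s := Finset.univ)
    (fun i => parity n i ≠ 0)
  rw [← hshift, Finset.card_univ, ZMod.card] at htotal
  omega

theorem card_parity_mul_parity_eq_zero :
    (Finset.univ.filter fun z : ZMod (2 * n) × ZMod (2 * n) =>
      parity n z.1 * parity n z.2 = 0).card = 3 * n ^ 2 := by
  have hcompl : (Finset.univ.filter fun z : ZMod (2 * n) × ZMod (2 * n) =>
      ¬ parity n z.1 * parity n z.2 = 0) =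
      (Finset.univ.filter fun i => parity n i ≠ 0) ×ˢ
        (Finset.univ.filter fun i => parity n i ≠ 0) := by
    ext z
    simp [not_or]
  have htotal := Finset.card_filter_add_card_filter_not (s := Finset.univ)
    (fun z : ZMod (2 * n) × ZMod (2 * n) => parity n z.1 * parity n z.2 = 0)
  rw [hcompl, Finset.card_product, card_parity_ne_zero, Finset.card_univ, Fintype.card_prod,
    ZMod.card] at htotal
  linarith

end Parity

theorem card_tmul_eq_one_of_cyclic_sum_equiv {G : Type*} [Group G] {N : ℕ} [NeZero N]
    (e : ZMod N ⊕ ZMod N ≃ G) (E : ZMod N × ZMod N → Prop) [DecidablePred E]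
    (hll : ∀ i j, tmul (e (.inl i)) (e (.inl j)) = 1 ↔ E (i, j))
    (hlr : ∀ i j, tmul (e (.inl i)) (e (.inr j)) = 1 ↔ i = 0)
    (hrr : ∀ i j, tmul (e (.inr i)) (e (.inr j)) ≠ 1) :
    Nat.card {z : G × G // tmul z.1 z.2 = 1} = (Finset.univ.filter E).card + 2 * N := by
  classical
  have htransport : Nat.card {z : G × G // tmul z.1 z.2 = 1} =
      Nat.card {z : (ZMod N ⊕ ZMod N) × (ZMod N ⊕ ZMod N) // tmul (e z.1) (e z.2) = 1} :=
    Nat.card_congr ((e.prodCongr e).subtypeEquiv fun z => Iff.rfl).symm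
  have hrl : ∀ i j, tmul (e (.inr i)) (e (.inl j)) = 1 ↔ j = 0 := fun i j =>
    tmul_eq_one_comm.trans (hlr j i)
  rw [htransport, Nat.card_eq_fintype_card, Fintype.card_subtype, Finset.card_filter,
    Fintype.sum_prod_type, Fintype.sum_sum_type]
  simp only [Fintype.sum_sum_type, hll, hlr, hrl, hrr, if_false, Finset.sum_add_distrib]
  rw [Finset.card_filter, Fintype.sum_prod_type]
  simp only [Finset.sum_ite_eq', Finset.sum_const, Finset.mem_univ, if_true, Finset.card_univ,
    ZMod.card, smul_eq_mul, mul_ite, mul_one, mul_zero]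
  ring

section Dihedral

open DihedralGroup

variable {N : ℕ}

/-- The crossed pairing of a dihedral group with values in the rotations, which is half of the
commutator: `⁅x, y⁆ = r (2 * dihedralPairing x y)`. -/
def dihedralPairing : DihedralGroup N → DihedralGroup N → ZMod N
  | r _, r _ => 0
  | r i, sr _ => i
  | sr _, r j => -j
  | sr i, sr j => j - i

theorem isCrossedPairing_dihedralPairing : IsCrossedPairing fun x y : DihedralGroup N =>
    Multiplicative.ofAdd (dihedralPairing x y) := by
  refine isCrossedPairing_ofAdd ?_ ?_ <;> rintro (i | i) (j | j) (k | k) <;>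
    simp only [r_mul_r, r_mul_sr, sr_mul_r, sr_mul_sr, inv_r, inv_sr, dihedralPairing] <;> ring

theorem tmul_r_sr_eq_one_iff (i j : ZMod N) : tmul (r i) (sr j) = 1 ↔ i = 0 := by
  refine ⟨isCrossedPairing_dihedralPairing.eq_one_of_tmul_eq_one, ?_⟩
  rintro rfl
  exact tmul_one_left _

/-- The homomorphism onto `ZMod 2` whose kernel is the group of rotations. -/
def dihedralSign : DihedralGroup N →* Multiplicative (ZMod 2) :=
  MonoidHom.mk' (fun | r _ => 1 | sr _ => Multiplicative.ofAdd 1) <| by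
    rintro (i | i) (j | j)
    exacts [rfl, rfl, rfl, (CharTwo.add_self_eq_zero (1 : ZMod 2)).symm]

theorem tmul_sr_sr_ne_one (i j : ZMod N) : tmul (sr i) (sr j) ≠ 1 := fun h =>
  one_ne_zero (α := ZMod 2) (hom_mul_hom_eq_zero dihedralSign dihedralSign h)

variable {n : ℕ}

/-- The homomorphism onto `ZMod 2` that is nontrivial on `r 1` and trivial on `sr 0`. -/
def dihedralParity (n : ℕ) : DihedralGroup (2 * n) →* Multiplicative (ZMod 2) :=
  MonoidHom.mk' (fun | r i => Multiplicative.ofAdd (parity n i)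
                     | sr i => Multiplicative.ofAdd (parity n i)) <| by
    rintro (i | i) (j | j) <;>
      simp only [r_mul_r, r_mul_sr, sr_mul_r, sr_mul_sr, map_add, map_sub, CharTwo.sub_eq_add,
        ← ofAdd_add, add_comm]

variable [NeZero n]

theorem tmul_r_r_eq_one_iff (i j : ZMod (2 * n)) :
    tmul (r i) (r j) = 1 ↔ parity n i * parity n j = 0 := by
  refine ⟨hom_mul_hom_eq_zero (dihedralParity n) (dihedralParity n), fun h => ?_⟩
  have hsq : tmul (r (1 : ZMod (2 * n))) (r 1) ^ 2 = 1 := by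
    rw [← tmul_sq_of_inverts (b := sr 0) (by simp), sq, sr_mul_self, tmul_one_right]
  simpa using tmul_pow_val_eq_one hsq h

theorem tensorDegree_dihedralGroup :
    tensorDegree (DihedralGroup (2 * n)) = (3 * n + 4) / (16 * n) := by
  have hcard := card_tmul_eq_one_of_cyclic_sum_equiv DihedralGroup.equivSum.symm
    (fun z => parity n z.1 * parity n z.2 = 0) tmul_r_r_eq_one_iff tmul_r_sr_eq_one_iff
    tmul_sr_sr_ne_one
  have hn : (n : ℚ) ≠ 0 := NeZero.ne _
  rw [tensorDegree, hcard, card_parity_mul_parity_eq_zero, DihedralGroup.nat_card]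
  push_cast
  field

end Dihedral

section Quaternion

open QuaternionGroup

variable {n : ℕ}

theorem inv_a (i : ZMod (2 * n)) : (a i : QuaternionGroup n)⁻¹ = a (-i) := rfl

theorem inv_xa (i : ZMod (2 * n)) : (xa i : QuaternionGroup n)⁻¹ = xa ((n : ZMod (2 * n)) + i) :=
  rfl

/-- The decomposition of a dicyclic group into its cyclic subgroup and the other coset. -/
def quaternionEquivSum : QuaternionGroup n ≃ ZMod (2 * n) ⊕ ZMod (2 * n) where
  toFun
    | a i => .inl i
    | xa i => .inr i
  invFun := Sum.elim a xa
  left_inv := by rintro (i | i) <;> rfl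
  right_inv := by rintro (i | i) <;> rfl

/-- The homomorphism onto `ZMod 2` whose kernel is the cyclic subgroup of the `a i`. -/
def quaternionSign : QuaternionGroup n →* Multiplicative (ZMod 2) :=
  MonoidHom.mk' (fun | a _ => 1 | xa _ => Multiplicative.ofAdd 1) <| by
    rintro (i | i) (j | j)
    exacts [rfl, rfl, rfl, (CharTwo.add_self_eq_zero (1 : ZMod 2)).symm]

theorem tmul_xa_xa_ne_one (i j : ZMod (2 * n)) :
    tmul (xa i : QuaternionGroup n) (xa j) ≠ 1 := fun h =>
  one_ne_zero (α := ZMod 2) (hom_mul_hom_eq_zero quaternionSign quaternionSign h)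

theorem xa_conj_a_one : (xa 0 : QuaternionGroup n) * a 1 * (xa 0)⁻¹ = (a 1)⁻¹ := by
  have hn : (n + n : ZMod (2 * n)) = 0 := by
    rw [← two_mul]
    exact_mod_cast ZMod.natCast_self (2 * n)
  simp [inv_a, inv_xa, hn]

theorem tmul_a_one_pow_eq_sq :
    tmul (a 1 : QuaternionGroup n) (a 1) ^ n = tmul (a 1) (a 1) ^ 2 := by
  rw [← tmul_sq_of_inverts xa_conj_a_one, xa_sq, ← tmul_pow_right (Commute.refl _), a_one_pow]

/-- The crossed pairing of a dicyclic group that is half of the commutator on the pairs that meet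
the cyclic subgroup; the shift by `n` on the other pairs corrects for `xa i ^ 2 = a (2 * n)`. -/
def quaternionPairing :
    QuaternionGroup (2 * n) → QuaternionGroup (2 * n) → ZMod (2 * (2 * n))
  | a _, a _ => 0
  | a i, xa _ => i
  | xa _, a j => -j
  | xa i, xa j => j - i + n

theorem isCrossedPairing_quaternionPairing : IsCrossedPairing fun x y : QuaternionGroup (2 * n) =>
    Multiplicative.ofAdd (quaternionPairing x y) := by
  have hfour : (4 * n : ZMod (2 * (2 * n))) = 0 := by
    have := ZMod.natCast_self (2 * (2 * n))
    push_cast at this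
    linear_combination this
  refine isCrossedPairing_ofAdd ?_ ?_ <;> rintro (i | i) (j | j) (k | k) <;>
    simp only [a_mul_a, a_mul_xa, xa_mul_a, xa_mul_xa, inv_a, inv_xa, quaternionPairing] <;>
    push_cast <;>
    first | ring1 | linear_combination hfour | linear_combination -hfour

theorem tmul_a_xa_eq_one_iff (i j : ZMod (2 * (2 * n))) :
    tmul (a i : QuaternionGroup (2 * n)) (xa j) = 1 ↔ i = 0 := by
  refine ⟨isCrossedPairing_quaternionPairing.eq_one_of_tmul_eq_one, ?_⟩
  rintro rfl
  exact tmul_one_left _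

/-- The homomorphism onto `ZMod 2` that is nontrivial on `a 1` and trivial on `xa 0`. -/
def quaternionParity (n : ℕ) : QuaternionGroup (2 * n) →* Multiplicative (ZMod 2) :=
  MonoidHom.mk' (fun | a i => Multiplicative.ofAdd (parity (2 * n) i)
                     | xa i => Multiplicative.ofAdd (parity (2 * n) i)) <| by
    have htwo : parity (2 * n) (2 * n : ℕ) = 0 := by
      rw [map_natCast, ZMod.natCast_eq_zero_iff]
      exact Dvd.intro n rfl
    rintro (i | i) (j | j) <;>
      simp only [a_mul_a, a_mul_xa, xa_mul_a, xa_mul_xa, map_add, map_sub, CharTwo.sub_eq_add,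
        htwo, zero_add, ← ofAdd_add, add_comm]

variable [NeZero n]

theorem tmul_a_a_eq_one_iff (i j : ZMod (2 * (2 * (2 * n)))) :
    tmul (a i : QuaternionGroup (2 * (2 * n))) (a j) = 1 ↔
      parity (2 * (2 * n)) i * parity (2 * (2 * n)) j = 0 := by
  refine ⟨hom_mul_hom_eq_zero (quaternionParity (2 * n)) (quaternionParity (2 * n)), fun h => ?_⟩
  have hsq : tmul (a 1 : QuaternionGroup (2 * (2 * n))) (a 1) ^ 2 = 1 := by
    rw [← tmul_a_one_pow_eq_sq, ← mul_assoc, pow_mul]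
    change (tmul (a 1) (a 1) ^ 4) ^ n = 1
    rw [tmul_self_pow_four_of_inverts xa_conj_a_one, one_pow]
  simpa using tmul_pow_val_eq_one hsq h

theorem tensorDegree_quaternionGroup :
    tensorDegree (QuaternionGroup (4 * n)) = (3 * n + 1) / (16 * n) := by
  rw [show 4 * n = 2 * (2 * n) by ring]
  have hcard := card_tmul_eq_one_of_cyclic_sum_equiv quaternionEquivSum.symm
    (fun z => parity (2 * (2 * n)) z.1 * parity (2 * (2 * n)) z.2 = 0) tmul_a_a_eq_one_iff
    tmul_a_xa_eq_one_iff tmul_xa_xa_ne_one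
  have hn : (n : ℚ) ≠ 0 := NeZero.ne _
  rw [tensorDegree, hcard, card_parity_mul_parity_eq_zero, Nat.card_eq_fintype_card,
    QuaternionGroup.card]
  push_cast
  field

/-- The automorphism of the quaternion group of order eight that interchanges `a 1` and `xa 0`. -/
def quaternionSwap : QuaternionGroup 2 →* QuaternionGroup 2 :=
  MonoidHom.mk' (fun | a i => xa 0 ^ i.val | xa i => a 1 * xa 0 ^ i.val) <| by decide

-- `quaternionSwap` moves `a i` and `a j` to the other coset where `quaternionPairing` is nonzero.
theorem tmul_a_a_eq_one_iff_mul_eq_zero (i j : ZMod 4) :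
    tmul (a i : QuaternionGroup 2) (a j) = 1 ↔ i * j = 0 := by
  constructor
  · intro h
    have hswap : quaternionPairing (n := 1) (quaternionSwap (a i)) (quaternionSwap (a j)) = 0 :=
      isCrossedPairing_quaternionPairing.eq_one_of_tmul_eq_one
        ((isCrossedPairing_map quaternionSwap).eq_one_of_tmul_eq_one h)
    clear h
    revert i j
    decide
  · intro h
    have hdvd : 4 ∣ i.val * j.val := by
      rw [← ZMod.natCast_eq_zero_iff, Nat.cast_mul, ZMod.natCast_zmod_val, ZMod.natCast_zmod_val, h]
    obtain ⟨k, hk⟩ := hdvd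
    have hpow : tmul (a 1 ^ i.val : QuaternionGroup 2) (a 1 ^ j.val) = 1 := by
      rw [tmul_pow_pow, hk, pow_mul, tmul_self_pow_four_of_inverts xa_conj_a_one, one_pow]
    simpa using hpow

theorem tensorDegree_quaternionGroup_two : tensorDegree (QuaternionGroup 2) = 1 / 4 := by
  have hcard := card_tmul_eq_one_of_cyclic_sum_equiv (N := 4) (quaternionEquivSum (n := 2)).symm
    (fun z => z.1 * z.2 = 0) tmul_a_a_eq_one_iff_mul_eq_zero (tmul_a_xa_eq_one_iff (n := 1))
    (tmul_xa_xa_ne_one (n := 2))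
  have hpairs : (Finset.univ.filter fun z : ZMod 4 × ZMod 4 => z.1 * z.2 = 0).card = 8 := by decide
  rw [tensorDegree, hcard, hpairs, Nat.card_eq_fintype_card, QuaternionGroup.card]
  norm_num

end Quaternion

section TensorCentralizer

variable {G : Type*} [Group G]

/-- The tensor centralizer `{h | x ⊗ h = 1}` of an element `x`. -/
def tensorCentralizer (x : G) : Subgroup G where
  carrier := {h | tmul x h = 1}
  one_mem' := tmul_one_right x
  mul_mem' {h k} hh hk := by
    rw [Set.mem_ofPred_eq] at hh hk ⊢
    rw [tmul_mul, hh, hk, smul_one, one_mul]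
  inv_mem' {h} hh := by
    rw [Set.mem_ofPred_eq] at hh ⊢
    rw [tmul_inv, hh, smul_one, inv_one]

theorem mem_tensorCentralizer {x h : G} : h ∈ tensorCentralizer x ↔ tmul x h = 1 := Iff.rfl

theorem mem_tensorCentralizer_comm {x h : G} :
    h ∈ tensorCentralizer x ↔ x ∈ tensorCentralizer h :=
  tmul_eq_one_comm

theorem tensorCentralizer_one : tensorCentralizer (1 : G) = ⊤ :=
  (Subgroup.eq_top_iff' _).2 tmul_one_left

theorem commutator_mem_tensorCentralizer {x y h : G} (hx : Commute h x) (hy : Commute h y) :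
    ⁅x, y⁆ ∈ tensorCentralizer h := by
  rw [mem_tensorCentralizer, tmul_commutator_right, smul_tmul_of_commute hx hy, mul_inv_cancel]

theorem tensorDegree_eq_sum [Fintype G] :
    tensorDegree G = (∑ x : G, (Nat.card (tensorCentralizer x) : ℚ)) / (Nat.card G : ℚ) ^ 2 := by
  rw [tensorDegree, Nat.card_congr (Equiv.subtypeProdEquivSigmaSubtype fun x y : G => tmul x y = 1),
    Nat.card_sigma, Nat.cast_sum]
  rfl

end TensorCentralizer

/-- The homomorphism `s ↦ g ^ s` from the additive group `ZMod p`. -/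
def zmodPowersHom {G : Type*} [Group G] {p : ℕ} [NeZero p] (g : G) (hg : g ^ p = 1) :
    Multiplicative (ZMod p) →* G :=
  MonoidHom.mk' (fun s => g ^ s.toAdd.val) fun s t => by
    rw [toAdd_mul, ZMod.val_add, ← pow_eq_pow_mod _ hg, pow_add]

/-- The Heisenberg group over `R`: the triple `(x, y, z)` stands for the unitriangular matrix with
rows `1, x, z`, `0, 1, y` and `0, 0, 1`. -/
@[ext]
structure Heisenberg (R : Type*) where
  x : R
  y : R
  z : R

namespace Heisenberg

section Ring

variable {R : Type*} [CommRing R]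

instance : Mul (Heisenberg R) := ⟨fun u v => ⟨u.x + v.x, u.y + v.y, u.z + v.z + u.x * v.y⟩⟩

instance : One (Heisenberg R) := ⟨⟨0, 0, 0⟩⟩

instance : Inv (Heisenberg R) := ⟨fun u => ⟨-u.x, -u.y, -u.z + u.x * u.y⟩⟩

@[simp] theorem mul_x (u v : Heisenberg R) : (u * v).x = u.x + v.x := rfl
@[simp] theorem mul_y (u v : Heisenberg R) : (u * v).y = u.y + v.y := rfl
@[simp] theorem mul_z (u v : Heisenberg R) : (u * v).z = u.z + v.z + u.x * v.y := rfl
@[simp] theorem one_x : (1 : Heisenberg R).x = 0 := rfl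
@[simp] theorem one_y : (1 : Heisenberg R).y = 0 := rfl
@[simp] theorem one_z : (1 : Heisenberg R).z = 0 := rfl
@[simp] theorem inv_x (u : Heisenberg R) : (u⁻¹).x = -u.x := rfl
@[simp] theorem inv_y (u : Heisenberg R) : (u⁻¹).y = -u.y := rfl
@[simp] theorem inv_z (u : Heisenberg R) : (u⁻¹).z = -u.z + u.x * u.y := rfl

instance : Group (Heisenberg R) :=
  Group.ofLeftAxioms
    (fun u v w => by ext <;> simp only [mul_x, mul_y, mul_z] <;> ring)
    (fun u => by ext <;> simp)
    (fun u => by ext <;> simp)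

/-- The underlying triple of an element of the Heisenberg group. -/
def equivProd (R : Type*) : Heisenberg R ≃ R × R × R where
  toFun u := (u.x, u.y, u.z)
  invFun t := ⟨t.1, t.2.1, t.2.2⟩

instance [Finite R] : Finite (Heisenberg R) := Finite.of_equiv _ (equivProd R).symm

theorem natCard (R : Type*) : Nat.card (Heisenberg R) = Nat.card R ^ 3 := by
  rw [Nat.card_congr (equivProd R), Nat.card_prod, Nat.card_prod]
  ring

theorem mem_center_iff {u : Heisenberg R} :
    u ∈ Subgroup.center (Heisenberg R) ↔ u.x = 0 ∧ u.y = 0 := by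
  rw [Subgroup.mem_center_iff]
  constructor
  · intro hu
    have hx := congrArg z (hu ⟨0, 1, 0⟩)
    have hy := congrArg z (hu ⟨1, 0, 0⟩)
    exact ⟨by simpa using hx.symm, by simpa using hy⟩
  · rintro ⟨hx, hy⟩ v
    ext <;> simp [hx, hy, add_comm]

theorem natCard_center (R : Type*) [CommRing R] :
    Nat.card (Subgroup.center (Heisenberg R)) = Nat.card R :=
  Nat.card_congr
    { toFun u := u.1.z
      invFun c := ⟨⟨0, 0, c⟩, mem_center_iff.2 ⟨rfl, rfl⟩⟩
      left_inv u := by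
        obtain ⟨hx, hy⟩ := mem_center_iff.1 u.2
        ext <;> simp [hx, hy]
      right_inv c := rfl }

theorem pow_eq_of_x_mul_y_eq_zero {u : Heisenberg R} (hu : u.x * u.y = 0) (n : ℕ) :
    u ^ n = ⟨n * u.x, n * u.y, n * u.z⟩ := by
  induction n with
  | zero => ext <;> simp
  | succ n ih =>
    rw [pow_succ, ih]
    ext <;> simp only [mul_x, mul_y, mul_z, Nat.cast_succ]
    · ring
    · ring
    · linear_combination (n : R) * hu

/-- The first coordinate as a homomorphism. -/
def xHom : Heisenberg R →* Multiplicative R := MonoidHom.mk' (fun u => .ofAdd u.x) fun _ _ => rfl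

/-- The second coordinate as a homomorphism. -/
def yHom : Heisenberg R →* Multiplicative R := MonoidHom.mk' (fun u => .ofAdd u.y) fun _ _ => rfl

/-- The automorphism of the Heisenberg group that lifts the symplectic map `(x, y) ↦ (y, -x)`. -/
def rotate : Heisenberg R →* Heisenberg R :=
  MonoidHom.mk' (fun u => ⟨u.y, -u.x, u.z - u.x * u.y⟩) fun u v => by
    ext <;> simp only [mul_x, mul_y, mul_z] <;> ring

/-- Twice the commutator of lifts of `u` and `v` to the central extension of the Heisenberg group
by `R` with the cocycle `u.x * v.z + u.x ^ 2 * v.y / 2`, a group of class three. -/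
def pairing (u v : Heisenberg R) : R :=
  2 * (u.x * v.z - v.x * u.z) + u.x ^ 2 * v.y - v.x ^ 2 * u.y

theorem isCrossedPairing_pairing :
    IsCrossedPairing fun u v : Heisenberg R => Multiplicative.ofAdd (pairing u v) := by
  refine isCrossedPairing_ofAdd ?_ ?_ <;> intro u v w <;>
    simp only [pairing, mul_x, mul_y, mul_z, inv_x, inv_y, inv_z] <;> ring

end Ring

section Field

variable {F : Type*} [Field F]

theorem mem_center_or_mem_center_of_tmul_eq_one {u v : Heisenberg F} (h : tmul u v = 1) :
    u ∈ Subgroup.center (Heisenberg F) ∨ v ∈ Subgroup.center (Heisenberg F) := by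
  have hxx : u.x * v.x = 0 := hom_mul_hom_eq_zero xHom xHom h
  have hxy : u.x * v.y = 0 := hom_mul_hom_eq_zero xHom yHom h
  have hyx : u.y * v.x = 0 := hom_mul_hom_eq_zero yHom xHom h
  have hyy : u.y * v.y = 0 := hom_mul_hom_eq_zero yHom yHom h
  rw [mul_eq_zero] at hxx hxy hyx hyy
  rw [mem_center_iff, mem_center_iff]
  tauto

theorem tensorCentralizer_eq_center (h2 : (2 : F) ≠ 0) {u : Heisenberg F}
    (hu : u ∈ Subgroup.center (Heisenberg F)) (hu1 : u ≠ 1) :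
    tensorCentralizer u = Subgroup.center (Heisenberg F) := by
  obtain ⟨hx, hy⟩ := mem_center_iff.1 hu
  have hz : u.z ≠ 0 := fun hz => hu1 (Heisenberg.ext hx hy hz)
  have hxv (v : Heisenberg F) (hv : pairing u v = 0) : v.x = 0 := by
    have : 2 * u.z * v.x = 0 := by
      rw [pairing, hx, hy] at hv
      linear_combination -hv
    exact (mul_eq_zero.1 this).resolve_left (mul_ne_zero h2 hz)
  have hrotate : rotate u = u := by ext <;> simp [rotate, hx, hy]
  ext v
  rw [mem_tensorCentralizer]
  constructor
  · intro h
    have hrot := (isCrossedPairing_map rotate).eq_one_of_tmul_eq_one h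
    rw [hrotate] at hrot
    exact mem_center_iff.2 ⟨hxv v (isCrossedPairing_pairing.eq_one_of_tmul_eq_one h),
      hxv (rotate v) (isCrossedPairing_pairing.eq_one_of_tmul_eq_one hrot)⟩
  · intro hv
    have hcomm : ⁅(⟨1, 0, 0⟩ : Heisenberg F), ⟨0, v.z, 0⟩⁆ = v := by
      obtain ⟨hx, hy⟩ := mem_center_iff.1 hv
      ext <;> simp [commutatorElement_def, hx, hy]
    rw [← mem_tensorCentralizer, ← hcomm]
    exact commutator_mem_tensorCentralizer (Subgroup.mem_center_iff.1 hu _).symm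
      (Subgroup.mem_center_iff.1 hu _).symm

theorem tensorCentralizer_eq_bot (h2 : (2 : F) ≠ 0) {u : Heisenberg F}
    (hu : u ∉ Subgroup.center (Heisenberg F)) : tensorCentralizer u = ⊥ := by
  rw [Subgroup.eq_bot_iff_forall]
  intro v hv
  have hvc := (mem_center_or_mem_center_of_tmul_eq_one hv).resolve_left hu
  by_contra hv1
  rw [mem_tensorCentralizer_comm, tensorCentralizer_eq_center h2 hvc hv1] at hv
  exact hu hv

theorem natCard_tensorCentralizer (h2 : (2 : F) ≠ 0) [DecidableEq (Heisenberg F)]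
    [DecidablePred (· ∈ Subgroup.center (Heisenberg F))] (u : Heisenberg F) :
    (Nat.card (tensorCentralizer u) : ℚ) =
      1 + (if u ∈ Subgroup.center (Heisenberg F) then (Nat.card F - 1 : ℚ) else 0) +
        (if u = 1 then (Nat.card F ^ 3 - Nat.card F : ℚ) else 0) := by
  by_cases hu : u ∈ Subgroup.center (Heisenberg F)
  · by_cases hu1 : u = 1
    · rw [if_pos hu, if_pos hu1, hu1, tensorCentralizer_one, Subgroup.card_top, natCard]
      push_cast
      ring
    · rw [if_pos hu, if_neg hu1, tensorCentralizer_eq_center h2 hu hu1, natCard_center]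
      ring
  · have hu1 : u ≠ 1 := by rintro rfl; exact hu (one_mem _)
    rw [if_neg hu, if_neg hu1, tensorCentralizer_eq_bot h2 hu, Subgroup.card_bot]
    norm_num

theorem tensorDegree_eq [Finite F] (h2 : (2 : F) ≠ 0) :
    tensorDegree (Heisenberg F) =
      (2 * (Nat.card F : ℚ) ^ 2 + Nat.card F - 2) / (Nat.card F : ℚ) ^ 5 := by
  classical
  have := Fintype.ofFinite (Heisenberg F)
  have hcard : (Nat.card F : ℚ) ≠ 0 := Nat.cast_ne_zero.2 Nat.card_pos.ne'
  have hcenter : ((Finset.univ.filter (· ∈ Subgroup.center (Heisenberg F))).card : ℚ) =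
      Nat.card F := by
    rw [← natCard_center F, Nat.card_eq_fintype_card, Fintype.card_subtype]
  rw [tensorDegree_eq_sum, natCard]
  simp only [natCard_tensorCentralizer h2, Finset.sum_add_distrib, Finset.sum_ite_eq',
    Finset.mem_univ, if_true, ← Finset.sum_filter, Finset.sum_const, Finset.card_univ,
    nsmul_eq_mul, hcenter, ← Nat.card_eq_fintype_card, natCard]
  push_cast
  field

end Field

section Lift

variable {R G : Type*} [CommRing R] [Group G]

/-- The homomorphism out of the Heisenberg group that is given on the three coordinate axes. -/
def lift (A B C : Multiplicative R →* G) (hCA : ∀ s t, Commute (C s) (A t))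
    (hCB : ∀ s t, Commute (C s) (B t))
    (hAB : ∀ s t : R,
      A (.ofAdd s) * B (.ofAdd t) = B (.ofAdd t) * A (.ofAdd s) * C (.ofAdd (s * t))) :
    Heisenberg R →* G :=
  MonoidHom.mk' (fun u => B (.ofAdd u.y) * A (.ofAdd u.x) * C (.ofAdd u.z)) fun u v => by
    have hCC (s t : R) : Commute (C (.ofAdd s)) (C (.ofAdd t)) := (Commute.all _ _).map C
    symm
    calc B (.ofAdd u.y) * A (.ofAdd u.x) * C (.ofAdd u.z) *
          (B (.ofAdd v.y) * A (.ofAdd v.x) * C (.ofAdd v.z))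
        = B (.ofAdd u.y) * (A (.ofAdd u.x) * B (.ofAdd v.y)) *
            (C (.ofAdd u.z) * A (.ofAdd v.x)) * C (.ofAdd v.z) := by
          simp only [mul_assoc, (hCB _ (.ofAdd v.y)).left_comm]
      _ = B (.ofAdd u.y) * B (.ofAdd v.y) * A (.ofAdd u.x) *
            (C (.ofAdd (u.x * v.y)) * A (.ofAdd v.x)) * C (.ofAdd u.z) * C (.ofAdd v.z) := by
          rw [hAB, (hCA (.ofAdd u.z) _).eq]
          simp only [mul_assoc]
      _ = B (.ofAdd (u * v).y) * A (.ofAdd (u * v).x) * C (.ofAdd (u * v).z) := by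
          rw [(hCA _ _).eq]
          simp only [mul_x, mul_y, mul_z, ofAdd_add, map_mul, mul_assoc,
            (hCC (u.x * v.y) u.z).left_comm, (hCC (u.x * v.y) v.z).eq]

theorem pow_mul_pow_eq {a b c : G} (hca : Commute c a) (hcb : Commute c b)
    (hab : a * b = b * a * c) (i j : ℕ) : a ^ i * b ^ j = b ^ j * a ^ i * c ^ (i * j) := by
  have hj : SemiconjBy (b ^ j) (a * c ^ j) a := by
    induction j with
    | zero => simp
    | succ j ih =>
      have hb : SemiconjBy b (a * c) a := by rw [SemiconjBy, hab, mul_assoc]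
      rw [pow_succ b, pow_succ' c, ← mul_assoc]
      exact ih.mul_left (hb.mul_right (hcb.pow_left j).symm)
  have hij := (hj.pow_right i).eq
  rw [(hca.pow_left j).symm.mul_pow, ← pow_mul, mul_comm j i, ← mul_assoc] at hij
  exact hij.symm

/-- The homomorphism from the Heisenberg group over `ZMod p` that maps the elements `(1, 0, 0)`,
`(0, 1, 0)` and `(0, 0, 1)` to `a`, `b` and `c`. -/
def ofGenerators {p : ℕ} [NeZero p] {a b c : G} (ha : a ^ p = 1) (hb : b ^ p = 1)
    (hc : c ^ p = 1) (hca : Commute c a) (hcb : Commute c b) (hab : a * b = b * a * c) :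
    Heisenberg (ZMod p) →* G :=
  lift (zmodPowersHom a ha) (zmodPowersHom b hb) (zmodPowersHom c hc)
    (fun _ _ => hca.pow_pow _ _) (fun _ _ => hcb.pow_pow _ _) fun s t =>
      (pow_mul_pow_eq hca hcb hab s.val t.val).trans <| congrArg _ <| by
        rw [pow_eq_pow_mod _ hc, ← ZMod.val_mul]
        rfl

theorem ofGenerators_apply {p : ℕ} [NeZero p] {a b c : G} (ha : a ^ p = 1) (hb : b ^ p = 1)
    (hc : c ^ p = 1) (hca : Commute c a) (hcb : Commute c b) (hab : a * b = b * a * c)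
    (u : Heisenberg (ZMod p)) :
    ofGenerators ha hb hc hca hcb hab u = b ^ u.y.val * a ^ u.x.val * c ^ u.z.val := rfl

end Lift

end Heisenberg

namespace ExtraspecialE1

variable {p : ℕ}

/-- The generators `a`, `b`, `c` of `E₁`. -/
def gen (i : Fin 3) : ExtraspecialE1 p := PresentedGroup.of i

theorem mk_eq_one {w : FreeGroup (Fin 3)} (hw : w ∈ extraspecialRels p) :
    PresentedGroup.mk (extraspecialRels p) w = 1 :=
  PresentedGroup.one_of_mem hw

theorem gen_pow (i : Fin 3) : (gen i : ExtraspecialE1 p) ^ p = 1 :=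
  mk_eq_one (w := FreeGroup.of i ^ p) (by fin_cases i <;> simp [extraspecialRels])

theorem commute_gen_two_zero : Commute (gen 2 : ExtraspecialE1 p) (gen 0) := by
  have h := mk_eq_one (p := p)
    (w := (FreeGroup.of 0)⁻¹ * (FreeGroup.of 2)⁻¹ * FreeGroup.of 0 * FreeGroup.of 2)
    (by simp [extraspecialRels])
  rw [mul_assoc, ← mul_inv_rev, map_mul, map_inv, inv_mul_eq_one] at h
  exact h

theorem commute_gen_two_one : Commute (gen 2 : ExtraspecialE1 p) (gen 1) := by
  have h := mk_eq_one (p := p)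
    (w := (FreeGroup.of 1)⁻¹ * (FreeGroup.of 2)⁻¹ * FreeGroup.of 1 * FreeGroup.of 2)
    (by simp [extraspecialRels])
  rw [mul_assoc, ← mul_inv_rev, map_mul, map_inv, inv_mul_eq_one] at h
  exact h

theorem gen_zero_mul_gen_one :
    (gen 0 * gen 1 : ExtraspecialE1 p) = gen 1 * gen 0 * gen 2 := by
  have h := mk_eq_one (p := p) (w := (FreeGroup.of 0)⁻¹ * (FreeGroup.of 1)⁻¹ * FreeGroup.of 0 *
    FreeGroup.of 1 * (FreeGroup.of 2)⁻¹) (by simp [extraspecialRels])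
  rw [map_mul, map_inv, mul_inv_eq_one, mul_assoc, ← mul_inv_rev, map_mul, map_inv,
    inv_mul_eq_iff_eq_mul] at h
  exact h

theorem lift_eq_one_of_mem_extraspecialRels {w : FreeGroup (Fin 3)} (hw : w ∈ extraspecialRels p) :
    FreeGroup.lift ![(⟨1, 0, 0⟩ : Heisenberg (ZMod p)), ⟨0, 1, 0⟩, ⟨0, 0, 1⟩] w = 1 := by
  have hpow {u : Heisenberg (ZMod p)} (hu : u.x * u.y = 0) : u ^ p = 1 := by
    rw [Heisenberg.pow_eq_of_x_mul_y_eq_zero hu, CharP.cast_eq_zero, zero_mul, zero_mul, zero_mul]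
    rfl
  rcases hw with rfl | rfl | rfl | rfl | rfl | rfl
  iterate 3
    · rw [map_pow, FreeGroup.lift_apply_of]
      exact hpow (by simp)
  all_goals
    simp only [map_mul, map_inv, FreeGroup.lift_apply_of]
    ext <;> simp

/-- `E₁` is the Heisenberg group over `ZMod p`. -/
def equivHeisenberg (p : ℕ) [Fact (1 < p)] : ExtraspecialE1 p ≃* Heisenberg (ZMod p) :=
  have : NeZero p := ⟨(zero_lt_one.trans Fact.out).ne'⟩
  MonoidHom.toMulEquiv (PresentedGroup.toGroup fun _ => lift_eq_one_of_mem_extraspecialRels)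
    (Heisenberg.ofGenerators (gen_pow 0) (gen_pow 1) (gen_pow 2) commute_gen_two_zero
      commute_gen_two_one gen_zero_mul_gen_one)
    (PresentedGroup.ext fun i => by
      rw [MonoidHom.comp_apply, PresentedGroup.toGroup.of, Heisenberg.ofGenerators_apply]
      fin_cases i <;> simp [ZMod.val_one, gen])
    (MonoidHom.ext fun u => by
      rw [MonoidHom.comp_apply, Heisenberg.ofGenerators_apply]
      simp only [gen, map_mul, map_pow, PresentedGroup.toGroup.of, Matrix.cons_val]
      rw [Heisenberg.pow_eq_of_x_mul_y_eq_zero (by simp),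
        Heisenberg.pow_eq_of_x_mul_y_eq_zero (by simp),
        Heisenberg.pow_eq_of_x_mul_y_eq_zero (by simp)]
      ext <;> simp)

theorem natCard [Fact (1 < p)] : Nat.card (ExtraspecialE1 p) = p ^ 3 := by
  rw [Nat.card_congr (equivHeisenberg p).toEquiv, Heisenberg.natCard, Nat.card_zmod]

end ExtraspecialE1

section OrderPrimeCubed

variable {p : ℕ} [Fact p.Prime] {G : Type*} [Group G]

theorem eq_top_of_not_commute (hG : Nat.card G = p ^ 3) {K : Subgroup G} {a b : G} (ha : a ∈ K)
    (hb : b ∈ K) (hab : ¬ Commute a b) : K = ⊤ := by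
  have hp : p.Prime := Fact.out
  have : Finite G := Nat.finite_of_card_ne_zero (hG ▸ pow_ne_zero 3 hp.ne_zero)
  have hK : ¬ IsMulCommutative K := fun h =>
    hab (congrArg Subtype.val (h.is_comm.comm ⟨a, ha⟩ ⟨b, hb⟩))
  obtain ⟨k, hk3, hk⟩ := (Nat.dvd_prime_pow hp).1 (hG ▸ K.card_subgroup_dvd_card)
  interval_cases k
  · have : Subsingleton K := (Nat.card_eq_one_iff_unique.1 (hk.trans (pow_zero p))).1
    exact absurd IsCyclic.isMulCommutative hK
  · have : IsCyclic K := isCyclic_of_prime_card (hk.trans (pow_one p))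
    exact absurd IsCyclic.isMulCommutative hK
  · exact absurd (IsPGroup.isMulCommutative_of_card_eq_prime_sq hk) hK
  · exact Subgroup.eq_top_of_card_eq K (hk.trans hG.symm)

theorem nonempty_mulEquiv_of_not_commute {L : Type*} [Group L] (hG : Nat.card G = p ^ 3)
    (hL : Nat.card L = p ^ 3) (φ : L →* G) {x y : L} (hxy : ¬ Commute (φ x) (φ y)) :
    Nonempty (G ≃* L) := by
  have : Finite L := Nat.finite_of_card_ne_zero (hL ▸ pow_ne_zero 3 (Fact.out : p.Prime).ne_zero)
  have hsurj : Function.Surjective φ :=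
    MonoidHom.range_eq_top.1 (eq_top_of_not_commute hG ⟨x, rfl⟩ ⟨y, rfl⟩ hxy)
  exact ⟨(MulEquiv.ofBijective φ
    ((Nat.bijective_iff_surjective_and_card φ).2 ⟨hsurj, hL.trans hG.symm⟩)).symm⟩

end OrderPrimeCubed

section QuaternionLift

variable {n : ℕ} [NeZero n] {G : Type*} [Group G] {g b : G}

theorem zmodPowersHom_mul_of_inverts (hg : g ^ n = 1) (hinv : b * g * b⁻¹ = g⁻¹) (i : ZMod n) :
    zmodPowersHom g hg (.ofAdd i) * b = b * zmodPowersHom g hg (.ofAdd (-i)) := by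
  have hconj : SemiconjBy b g g⁻¹ := mul_inv_eq_iff_eq_mul.1 hinv
  have hpow := (hconj.inv_right.pow_right i.val).eq.symm
  rw [inv_inv, inv_pow] at hpow
  rw [ofAdd_neg, map_inv]
  exact hpow

open QuaternionGroup in
/-- The homomorphism from the quaternion group of order `4 * n` that maps its standard generators
to `g` and `b`. -/
def quaternionLift (hg : g ^ (2 * n) = 1) (hb : b ^ 2 = g ^ n) (hinv : b * g * b⁻¹ = g⁻¹) :
    QuaternionGroup n →* G :=
  let A := zmodPowersHom g hg
  MonoidHom.mk' (fun | a i => A (.ofAdd i) | xa i => b * A (.ofAdd i)) <| by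
    have hcomm (i : ZMod (2 * n)) : A (.ofAdd i) * b = b * A (.ofAdd (-i)) :=
      zmodPowersHom_mul_of_inverts hg hinv i
    have hn : A (.ofAdd (n : ZMod (2 * n))) = b * b := by
      rw [← sq, hb]
      change g ^ (n : ZMod (2 * n)).val = g ^ n
      rw [ZMod.val_natCast, ← pow_eq_pow_mod n hg]
    rintro (i | i) (j | j)
    · exact map_mul A _ _
    · change b * A (.ofAdd (j - i)) = A (.ofAdd i) * (b * A (.ofAdd j))
      rw [← mul_assoc, hcomm, mul_assoc, ← map_mul, ← ofAdd_add, neg_add_eq_sub]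
    · change b * A (.ofAdd (i + j)) = b * A (.ofAdd i) * A (.ofAdd j)
      rw [ofAdd_add, map_mul, mul_assoc]
    · change A (.ofAdd ((n : ZMod (2 * n)) + j - i)) = b * A (.ofAdd i) * (b * A (.ofAdd j))
      rw [mul_assoc, ← mul_assoc (A _), hcomm, mul_assoc, ← map_mul, ← ofAdd_add, ← mul_assoc,
        ← hn, ← map_mul, ← ofAdd_add, neg_add_eq_sub, add_sub_assoc]

end QuaternionLift

theorem commute_of_mem_center {G : Type*} [Group G] {z : G} (hz : z ∈ Subgroup.center G) (x : G) :
    Commute z x :=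
  IsMulCentral.comm hz x

theorem exists_not_commute_of_notMem_center {G : Type*} [Group G] {x : G}
    (hx : x ∉ Subgroup.center G) : ∃ y, ¬ Commute x y := by
  contrapose! hx
  exact Subgroup.mem_center_iff.2 fun y => (hx y).symm

namespace IsExtraspecial

variable {p : ℕ} {H : Type*} [Group H]

theorem commutator_mem_center (hH : IsExtraspecial p H) (x y : H) : ⁅x, y⁆ ∈ Subgroup.center H :=
  hH.commutator_eq_center ▸
    Subgroup.commutator_mem_commutator (Subgroup.mem_top x) (Subgroup.mem_top y)

theorem pow_eq_one_of_mem_center (hH : IsExtraspecial p H) {z : H} (hz : z ∈ Subgroup.center H) :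
    z ^ p = 1 := by
  rw [← hH.card_center]
  exact congrArg Subtype.val (pow_card_eq_one' (x := (⟨z, hz⟩ : Subgroup.center H)))

/-- Commutation with `u`, as a homomorphism to the center. -/
def commutatorHom (hH : IsExtraspecial p H) (u : H) : H →* Subgroup.center H :=
  MonoidHom.mk' (fun x => ⟨⁅x, u⁆, hH.commutator_mem_center x u⟩) fun x y => Subtype.ext <| by
    have hcomm := commute_of_mem_center (hH.commutator_mem_center y u)
    calc ⁅x * y, u⁆ = x * ⁅y, u⁆ * x⁻¹ * ⁅x, u⁆ := by simp only [commutatorElement_def]; group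
      _ = ⁅x, u⁆ * ⁅y, u⁆ := by rw [← (hcomm x).eq, mul_inv_cancel_right, (hcomm _).eq]

theorem commutatorHom_eq_one_iff (hH : IsExtraspecial p H) {x u : H} :
    hH.commutatorHom u x = 1 ↔ Commute x u :=
  Subtype.ext_iff.trans commutatorElement_eq_one_iff_commute

theorem index_ker_commutatorHom_dvd (hH : IsExtraspecial p H) (u : H) :
    (hH.commutatorHom u).ker.index ∣ p := by
  rw [Subgroup.index_ker]
  exact (Subgroup.card_subgroup_dvd_card _).trans hH.card_center.dvd

variable [hp : Fact p.Prime]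

theorem exists_not_commute (hH : IsExtraspecial p H) : ∃ x y : H, ¬ Commute x y := by
  by_contra! hcomm
  have hbot : commutator H = ⊥ :=
    (commutator_eq_bot_iff H).2 ⟨⟨hcomm⟩⟩
  have hcard := hH.card_center
  rw [← hH.commutator_eq_center, hbot, Subgroup.card_bot] at hcard
  exact hp.out.one_lt.ne hcard

theorem mem_center_or_mem_center_of_tmul_eq_one (hH : IsExtraspecial p H) {x y : H}
    (h : tmul x y = 1) : x ∈ Subgroup.center H ∨ y ∈ Subgroup.center H := by
  by_contra! hxy
  obtain ⟨u, hu⟩ := exists_not_commute_of_notMem_center hxy.1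
  obtain ⟨v, hv⟩ := exists_not_commute_of_notMem_center hxy.2
  let e : Subgroup.center H ≃* Multiplicative (ZMod p) :=
    mulEquivOfPrimeCardEq (p := p) hH.card_center (by simp)
  have hf {w : H} {z : H} (hz : (e (hH.commutatorHom w z)).toAdd = 0) : Commute z w :=
    hH.commutatorHom_eq_one_iff.1 ((map_eq_one_iff e e.injective).1 hz)
  rcases mul_eq_zero.1 (hom_mul_hom_eq_zero (e.toMonoidHom.comp (hH.commutatorHom u))
    (e.toMonoidHom.comp (hH.commutatorHom v)) h) with hx | hy
  · exact hu (hf hx)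
  · exact hv (hf hy)

theorem natCard_tensorCentralizer (hH : IsExtraspecial p H)
    (hZ : ∀ y : H, Subgroup.center H ≤ tensorCentralizer y)
    [DecidablePred (· ∈ Subgroup.center H)] (x : H) :
    (Nat.card (tensorCentralizer x) : ℚ) =
      p + if x ∈ Subgroup.center H then (Nat.card H - p : ℚ) else 0 := by
  by_cases hx : x ∈ Subgroup.center H
  · have htop : tensorCentralizer x = ⊤ :=
      (Subgroup.eq_top_iff' _).2 fun y => mem_tensorCentralizer_comm.2 (hZ y hx)
    rw [if_pos hx, htop, Subgroup.card_top, add_sub_cancel]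
  · have hcenter : tensorCentralizer x = Subgroup.center H :=
      le_antisymm
        (fun y hy => (hH.mem_center_or_mem_center_of_tmul_eq_one hy).resolve_left hx) (hZ x)
    rw [if_neg hx, hcenter, hH.card_center, add_zero]

theorem tensorDegree_of_center_le_tensorCentralizer (hH : IsExtraspecial p H)
    (hZ : ∀ y : H, Subgroup.center H ≤ tensorCentralizer y) {m : ℕ}
    (hcard : Nat.card H = p ^ (2 * m + 1)) :
    tensorDegree H = (2 * (p : ℚ) ^ (2 * m) - 1) / (p : ℚ) ^ (4 * m) := by
  classical
  have : Finite H := Nat.finite_of_card_ne_zero (hcard ▸ pow_ne_zero _ hp.out.ne_zero)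
  have := Fintype.ofFinite H
  have hp0 : (p : ℚ) ≠ 0 := Nat.cast_ne_zero.2 hp.out.ne_zero
  have hcenter : ((Finset.univ.filter (· ∈ Subgroup.center H)).card : ℚ) = p := by
    rw [← Fintype.card_subtype, ← Nat.card_eq_fintype_card, ← hH.card_center]
  rw [tensorDegree_eq_sum]
  simp only [hH.natCard_tensorCentralizer hZ, Finset.sum_add_distrib, ← Finset.sum_filter,
    Finset.sum_const, Finset.card_univ, nsmul_eq_mul, hcenter, ← Nat.card_eq_fintype_card, hcard]
  push_cast
  field

section CenterLeTensorCentralizer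

theorem exists_pow_eq_of_mem_center (hH : IsExtraspecial p H) {c z : H}
    (hc : c ∈ Subgroup.center H) (hc1 : c ≠ 1) (hz : z ∈ Subgroup.center H) :
    ∃ n : ℕ, c ^ n = z := by
  obtain ⟨n, hn⟩ := mem_powers_of_prime_card (g := (⟨c, hc⟩ : Subgroup.center H)) (g' := ⟨z, hz⟩)
    hH.card_center (Subtype.coe_ne_coe.1 hc1)
  exact ⟨n, congrArg Subtype.val hn⟩

theorem center_le_tensorCentralizer_of_mem (hH : IsExtraspecial p H) {c h : H}
    (hc : c ∈ Subgroup.center H) (hc1 : c ≠ 1) (hch : c ∈ tensorCentralizer h) :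
    Subgroup.center H ≤ tensorCentralizer h := by
  intro z hz
  obtain ⟨n, rfl⟩ := hH.exists_pow_eq_of_mem_center hc hc1 hz
  exact pow_mem hch n

-- The centralizer of `h` is maximal, having prime index, and that of `x` contains both it and `t`.
theorem mem_center_of_commute (hH : IsExtraspecial p H) {h t x : H} (ht : ¬ Commute t h)
    (htx : Commute t x) (hx : ∀ y, Commute y h → Commute y x) : x ∈ Subgroup.center H := by
  let K := (hH.commutatorHom h).ker
  let L := (hH.commutatorHom x).ker
  have hKL : K ≤ L := fun y hy =>
    hH.commutatorHom_eq_one_iff.2 (hx y (hH.commutatorHom_eq_one_iff.1 hy))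
  have hLK : ¬ L ≤ K := fun hle =>
    ht (hH.commutatorHom_eq_one_iff.1 (hle (hH.commutatorHom_eq_one_iff.2 htx)))
  have hindex := Subgroup.relIndex_mul_index hKL
  have hL : L.index = 1 := by
    refine ((Nat.dvd_prime hp.out).1 (hH.index_ker_commutatorHom_dvd x)).resolve_right fun hLp => ?_
    have hKp : K.index = p := Nat.dvd_antisymm (hH.index_ker_commutatorHom_dvd h)
      (hLp ▸ Subgroup.index_dvd_of_le hKL)
    change L.index = p at hLp
    rw [hLp, hKp] at hindex
    exact hLK (Subgroup.relIndex_eq_one.1 ((Nat.mul_eq_right hp.out.ne_zero).1 hindex))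
  refine Subgroup.mem_center_iff.2 fun y => ?_
  exact hH.commutatorHom_eq_one_iff.1 (Subgroup.index_eq_one.1 hL ▸ Subgroup.mem_top y : y ∈ L)

theorem exists_not_commute_of_lt_card (hH : IsExtraspecial p H) (hcard : p ^ 3 < Nat.card H)
    (h : H) : ∃ x y : H, Commute h x ∧ Commute h y ∧ ¬ Commute x y := by
  by_cases hh : h ∈ Subgroup.center H
  · obtain ⟨x, y, hxy⟩ := hH.exists_not_commute
    exact ⟨x, y, commute_of_mem_center hh x, commute_of_mem_center hh y, hxy⟩
  by_contra! hcomm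
  obtain ⟨t, ht⟩ := exists_not_commute_of_notMem_center hh
  have hle : (hH.commutatorHom h).ker ⊓ (hH.commutatorHom t).ker ≤ Subgroup.center H := by
    rintro x ⟨hxh, hxt⟩
    have hxh := (hH.commutatorHom_eq_one_iff.1 hxh).symm
    exact hH.mem_center_of_commute (fun hth => ht hth.symm)
      (hH.commutatorHom_eq_one_iff.1 hxt).symm fun y hy => hcomm y x hy.symm hxh
  have hindex (u : H) : (hH.commutatorHom u).ker.index ≤ p :=
    Nat.le_of_dvd hp.out.pos (hH.index_ker_commutatorHom_dvd u)
  have : Finite H := Nat.finite_of_card_ne_zero (Nat.ne_zero_of_lt hcard)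
  refine hcard.not_ge ?_
  calc Nat.card H
      = Nat.card ↥((hH.commutatorHom h).ker ⊓ (hH.commutatorHom t).ker) *
          ((hH.commutatorHom h).ker ⊓ (hH.commutatorHom t).ker).index :=
        (Subgroup.card_mul_index _).symm
    _ ≤ p * (p * p) :=
        Nat.mul_le_mul ((Subgroup.card_le_of_le hle).trans_eq hH.card_center)
          (Subgroup.index_inf_le.trans (Nat.mul_le_mul (hindex h) (hindex t)))
    _ = p ^ 3 := by ring

theorem center_le_tensorCentralizer_of_lt_card (hH : IsExtraspecial p H)
    (hcard : p ^ 3 < Nat.card H) (h : H) : Subgroup.center H ≤ tensorCentralizer h := by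
  obtain ⟨x, y, hx, hy, hxy⟩ := hH.exists_not_commute_of_lt_card hcard h
  exact hH.center_le_tensorCentralizer_of_mem (hH.commutator_mem_center x y)
    (mt commutatorElement_eq_one_iff_commute.1 hxy) (commutator_mem_tensorCentralizer hx hy)

theorem tmul_pow_prime_left (hH : IsExtraspecial p H) (h2 : p ≠ 2) (g y : H) :
    tmul (g ^ p) y = tmul g y ^ p := by
  have hmem := hH.commutator_mem_center g y
  have hcomm := (commute_of_mem_center hmem g).symm
  obtain ⟨k, hk⟩ : p ∣ p.choose 2 :=
    hp.out.dvd_choose_self two_ne_zero (lt_of_le_of_ne hp.out.two_le h2.symm)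
  rw [tmul_pow_left_of_commute_commutator hcomm, hk, pow_mul, ← tmul_pow_right hcomm,
    hH.pow_eq_one_of_mem_center hmem, tmul_one_right, one_pow, one_mul]

theorem tmul_pow_prime_right (hH : IsExtraspecial p H) (h2 : p ≠ 2) (g y : H) :
    tmul g (y ^ p) = tmul g y ^ p := by
  have h := congrArg isCrossedPairing_swap.lift (hH.tmul_pow_prime_left h2 y g)
  rwa [map_pow, IsCrossedPairing.lift_tmul, IsCrossedPairing.lift_tmul, inv_pow, inv_inj] at h

theorem center_le_tensorCentralizer_self_of_pow_ne_one (hH : IsExtraspecial p H) (h2 : p ≠ 2)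
    {g : H} (hg : g ^ p ≠ 1) : Subgroup.center H ≤ tensorCentralizer g := by
  have hgc : g ∉ Subgroup.center H := fun h => hg (hH.pow_eq_one_of_mem_center h)
  obtain ⟨y, hy⟩ := exists_not_commute_of_notMem_center hgc
  have hmem := hH.commutator_mem_center g y
  have hcomm := commute_of_mem_center hmem g
  refine hH.center_le_tensorCentralizer_of_mem hmem
    (mt commutatorElement_eq_one_iff_commute.1 hy) ?_
  rw [mem_tensorCentralizer_comm, mem_tensorCentralizer]
  have hsymm : tmul ⁅g, y⁆ g = tmul g ⁅g, y⁆ := by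
    obtain ⟨n, hn⟩ := hH.exists_pow_eq_of_mem_center (hH.pow_mem_center g) hg hmem
    rw [← hn, ← pow_mul, tmul_pow_left (Commute.refl g), tmul_pow_right (Commute.refl g)]
  have hsq : tmul ⁅g, y⁆ g ^ 2 = 1 := by
    rw [sq, ← eq_inv_iff_mul_eq_one, hsymm, ← tmul_commutator_self, hsymm]
  have hpow : tmul ⁅g, y⁆ g ^ p = 1 := by
    rw [← tmul_pow_left hcomm, hH.pow_eq_one_of_mem_center hmem, tmul_one_left]
  have hcop : Nat.Coprime 2 p := (Nat.coprime_primes Nat.prime_two hp.out).2 h2.symm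
  exact orderOf_eq_one_iff.1 (Nat.eq_one_of_dvd_coprimes hcop (orderOf_dvd_of_pow_eq_one hsq)
    (orderOf_dvd_of_pow_eq_one hpow))

theorem center_le_tensorCentralizer_of_pow_ne_one (hH : IsExtraspecial p H) (h2 : p ≠ 2) {g : H}
    (hg : g ^ p ≠ 1) (y : H) : Subgroup.center H ≤ tensorCentralizer y := by
  refine hH.center_le_tensorCentralizer_of_mem (hH.pow_mem_center g) hg ?_
  rw [mem_tensorCentralizer_comm, mem_tensorCentralizer, hH.tmul_pow_prime_left h2,
    ← hH.tmul_pow_prime_right h2]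
  exact hH.center_le_tensorCentralizer_self_of_pow_ne_one h2 hg (hH.pow_mem_center y)

end CenterLeTensorCentralizer

section OrderPrimeCubed

theorem nonempty_mulEquiv_extraspecialE1 (hH : IsExtraspecial p H) (hcard : Nat.card H = p ^ 3)
    {a b : H} (ha : a ^ p = 1) (hb : b ^ p = 1) (hab : ¬ Commute a b) :
    Nonempty (H ≃* ExtraspecialE1 p) := by
  have : Fact (1 < p) := ⟨hp.out.one_lt⟩
  have hmem := hH.commutator_mem_center a⁻¹ b⁻¹
  have hcomm := commute_of_mem_center hmem
  let φ := Heisenberg.ofGenerators ha hb (hH.pow_eq_one_of_mem_center hmem) (hcomm a) (hcomm b)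
    (by rw [commutatorElement_def]; group)
  have hφa : φ ⟨1, 0, 0⟩ = a := by simp [φ, Heisenberg.ofGenerators_apply, ZMod.val_one]
  have hφb : φ ⟨0, 1, 0⟩ = b := by simp [φ, Heisenberg.ofGenerators_apply, ZMod.val_one]
  refine nonempty_mulEquiv_of_not_commute hcard ExtraspecialE1.natCard
    (φ.comp (ExtraspecialE1.equivHeisenberg p).toMonoidHom)
    (x := (ExtraspecialE1.equivHeisenberg p).symm ⟨1, 0, 0⟩)
    (y := (ExtraspecialE1.equivHeisenberg p).symm ⟨0, 1, 0⟩) ?_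
  simpa [hφa, hφb] using hab

theorem eq_of_mem_center_of_ne_one {H : Type*} [Group H] (hH : IsExtraspecial 2 H) {w z : H}
    (hw : w ∈ Subgroup.center H) (hw1 : w ≠ 1) (hz : z ∈ Subgroup.center H) (hz1 : z ≠ 1) :
    w = z :=
  congrArg Subtype.val <| ((Nat.card_eq_two_iff' (1 : Subgroup.center H)).1 hH.card_center).unique
    (y₁ := ⟨w, hw⟩) (y₂ := ⟨z, hz⟩) (Subtype.coe_ne_coe.1 hw1) (Subtype.coe_ne_coe.1 hz1)

theorem nonempty_mulEquiv_of_sq_ne_one {H : Type*} [Group H] (hH : IsExtraspecial 2 H)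
    (hcard : Nat.card H = 2 ^ 3) {g b : H} (hgb : ¬ Commute g b) (hg : g ^ 2 ≠ 1) :
    Nonempty (H ≃* ExtraspecialE1 2) ∨ Nonempty (H ≃* QuaternionGroup 2) := by
  have hmem := hH.pow_mem_center g
  have hcomm : ⁅g, b⁆ = g ^ 2 := hH.eq_of_mem_center_of_ne_one (hH.commutator_mem_center g b)
    (mt commutatorElement_eq_one_iff_commute.1 hgb) hmem hg
  have hinv : b * g * b⁻¹ = g⁻¹ := by
    have hbg : g * (b * g * b⁻¹)⁻¹ = g * g := by
      rw [← sq, ← hcomm, commutatorElement_def]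
      group
    exact inv_eq_iff_eq_inv.1 (mul_left_cancel hbg)
  by_cases hb : b ^ 2 = 1
  · have hgb2 : (g * b) ^ 2 = 1 := by
      rw [mul_inv_eq_iff_eq_mul] at hinv
      rw [sq, mul_assoc, ← mul_assoc b, hinv, mul_assoc, mul_inv_cancel_left, ← sq, hb]
    refine .inl (hH.nonempty_mulEquiv_extraspecialE1 hcard hgb2 hb fun h => hgb ?_)
    simpa using h.mul_left (Commute.refl b).inv_left
  · have hb2 : b ^ 2 = g ^ 2 := hH.eq_of_mem_center_of_ne_one (hH.pow_mem_center b) hb hmem hg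
    have hg4 : g ^ (2 * 2) = 1 := by rw [pow_mul, hH.pow_eq_one_of_mem_center hmem]
    let φ := quaternionLift hg4 hb2 hinv
    have hφg : φ (.a 1) = g := pow_one g
    have hφb : φ (.xa 0) = b := (congrArg (b * ·) (pow_zero g)).trans (mul_one b)
    refine .inr (nonempty_mulEquiv_of_not_commute hcard ?_ φ (x := .a 1) (y := .xa 0) ?_)
    · rw [Nat.card_eq_fintype_card, QuaternionGroup.card]
      norm_num
    · rwa [hφg, hφb]

theorem nonempty_mulEquiv_of_card_eq_eight {H : Type*} [Group H] (hH : IsExtraspecial 2 H)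
    (hcard : Nat.card H = 2 ^ 3) :
    Nonempty (H ≃* ExtraspecialE1 2) ∨ Nonempty (H ≃* QuaternionGroup 2) := by
  obtain ⟨x, y, hxy⟩ := hH.exists_not_commute
  by_cases hx : x ^ 2 = 1
  · by_cases hy : y ^ 2 = 1
    · exact .inl (hH.nonempty_mulEquiv_extraspecialE1 hcard hx hy hxy)
    · exact hH.nonempty_mulEquiv_of_sq_ne_one hcard (fun h => hxy h.symm) hy
  · exact hH.nonempty_mulEquiv_of_sq_ne_one hcard hxy hx

end OrderPrimeCubed

theorem tensorDegree_eq (hH : IsExtraspecial p H) {m : ℕ} (hm : 1 ≤ m)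
    (hcard : Nat.card H = p ^ (2 * m + 1)) (hE : IsEmpty (H ≃* ExtraspecialE1 p))
    (hQ : IsEmpty (H ≃* QuaternionGroup 2)) :
    tensorDegree H = (2 * (p : ℚ) ^ (2 * m) - 1) / (p : ℚ) ^ (4 * m) := by
  suffices hZ : ∀ y, Subgroup.center H ≤ tensorCentralizer y from
    hH.tensorDegree_of_center_le_tensorCentralizer hZ hcard
  rcases hm.eq_or_lt with rfl | hm
  · rcases eq_or_ne p 2 with rfl | h2
    · rcases hH.nonempty_mulEquiv_of_card_eq_eight hcard with e | e
      · exact (not_isEmpty_iff.2 e hE).elim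
      · exact (not_isEmpty_iff.2 e hQ).elim
    · obtain ⟨a, b, hab⟩ := hH.exists_not_commute
      by_cases hexp : ∀ g : H, g ^ p = 1
      · exact (not_isEmpty_iff.2
          (hH.nonempty_mulEquiv_extraspecialE1 hcard (hexp a) (hexp b) hab) hE).elim
      · obtain ⟨g, hg⟩ := not_forall.1 hexp
        exact hH.center_le_tensorCentralizer_of_pow_ne_one h2 hg
  · exact hH.center_le_tensorCentralizer_of_lt_card
      (hcard ▸ Nat.pow_lt_pow_right hp.out.one_lt (by lia))

end IsExtraspecial

theorem two_pow_fraction_eq {n : ℕ} (hn : 3 < n) :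
    (3 * ((2 ^ (n - 4) : ℕ) : ℚ) + 1) / (16 * (2 ^ (n - 4) : ℕ)) =
      (2 ^ (n - 3) + 2 ^ (n - 4) + 1) / 2 ^ n := by
  obtain ⟨k, rfl⟩ := Nat.exists_eq_add_of_le' hn
  rw [show k + 4 - 3 = k + 1 by lia, Nat.add_sub_cancel]
  push_cast
  field

theorem two_pow_sub_eq {n i : ℕ} (hn : 3 < n) (hi : i ≤ 4) :
    2 ^ (n - i) = 2 ^ (4 - i) * 2 ^ (n - 4) := by
  rw [← pow_add]
  congr 1
  lia

end TensorDegree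

open TensorDegree in
theorem theorem4p3_general :
    (∀ n : ℕ, n ≠ 0 → tensorDegree (QuaternionGroup (4 * n)) = (3 * n + 1) / (16 * n)) ∧
    tensorDegree (QuaternionGroup 2) = 1 / 4 ∧
    (∀ n : ℕ, n ≠ 0 → tensorDegree (DihedralGroup (2 * n)) = (3 * n + 4) / (16 * n)) ∧
    (∀ (F : Type*) [Field F] [Finite F], (2 : F) ≠ 0 →
      tensorDegree (Heisenberg F) =
        (2 * (Nat.card F : ℚ) ^ 2 + Nat.card F - 2) / (Nat.card F : ℚ) ^ 5) ∧
    (∀ p : ℕ, p.Prime → ∀ m : ℕ, 1 ≤ m → ∀ (H : Type*) [Group H], IsExtraspecial p H →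
      Nat.card H = p ^ (2 * m + 1) → IsEmpty (H ≃* ExtraspecialE1 p) →
      IsEmpty (H ≃* QuaternionGroup 2) →
      tensorDegree H = (2 * (p : ℚ) ^ (2 * m) - 1) / (p : ℚ) ^ (4 * m)) :=
  ⟨fun _ hn => have := NeZero.mk hn; tensorDegree_quaternionGroup,
    tensorDegree_quaternionGroup_two,
    fun _ hn => have := NeZero.mk hn; tensorDegree_dihedralGroup,
    fun _ _ _ h2 => Heisenberg.tensorDegree_eq h2,
    fun _ hp _ hm _ _ hH hcard hE hQ => have := Fact.mk hp; hH.tensorDegree_eq hm hcard hE hQ⟩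

theorem theorem4p3 :
    (∀ n : ℕ, 3 < n →
      TensorDegree.tensorDegree (QuaternionGroup (2 ^ (n - 2))) =
        ((2 : ℚ) ^ (n - 3) + 2 ^ (n - 4) + 1) / 2 ^ n) ∧
    TensorDegree.tensorDegree (QuaternionGroup 2) = 1 / 4 ∧
    (∀ n : ℕ, 3 < n →
      TensorDegree.tensorDegree (DihedralGroup (2 ^ (n - 1))) =
        ((2 : ℚ) ^ (n - 3) + 2 ^ (n - 4) + 1) / 2 ^ n) ∧
    TensorDegree.tensorDegree (DihedralGroup 4) = 5 / 16 ∧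
    (∀ p : ℕ, p.Prime → p ≠ 2 →
      TensorDegree.tensorDegree (TensorDegree.ExtraspecialE1 p) =
        (2 * (p : ℚ) ^ 2 + p - 2) / (p : ℚ) ^ 5) ∧
    (∀ p : ℕ, p.Prime → ∀ m : ℕ, 1 ≤ m → ∀ (H : Type*) [Group H],
      TensorDegree.IsExtraspecial p H →
      Nat.card H = p ^ (2 * m + 1) →
      IsEmpty (H ≃* TensorDegree.ExtraspecialE1 p) →
      IsEmpty (H ≃* QuaternionGroup 2) →
      IsEmpty (H ≃* DihedralGroup 4) →
      TensorDegree.tensorDegree H =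
        (2 * (p : ℚ) ^ (2 * m) - 1) / (p : ℚ) ^ (4 * m)) := by
  open TensorDegree in
  obtain ⟨hQ, hQ8, hD, hF, hH⟩ := theorem4p3_general.{0}
  refine ⟨fun n hn => ?_, hQ8, fun n hn => ?_, ?_, fun p hp h2 => ?_,
    fun p hp m hm H _ hE hcard h₁ h₂ _ => hH p hp m hm H hE hcard h₁ h₂⟩
  · have hpow : 2 ^ (n - 2) = 4 * 2 ^ (n - 4) := two_pow_sub_eq hn (by norm_num)
    rw [hpow, hQ _ (by positivity), two_pow_fraction_eq hn]
  · have hpow : 2 ^ (n - 1) = 2 * (4 * 2 ^ (n - 4)) :=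
      (two_pow_sub_eq hn (by norm_num)).trans (mul_assoc 2 4 _)
    rw [hpow, hD _ (by positivity), ← two_pow_fraction_eq hn]
    push_cast
    field
  · exact (hD 2 two_ne_zero).trans (by norm_num)
  · have := Fact.mk hp
    have := Fact.mk hp.one_lt
    rw [tensorDegree_congr (ExtraspecialE1.equivHeisenberg p), hF (ZMod p), Nat.card_zmod]
    exact Ring.two_ne_zero (by rwa [ZMod.ringChar_zmod_n])
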